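/- For $T\ge 0$ let $c_{\rm ww}(k)=\sqrt{(1+Tk^2)\tanh(k)/k}$ for $k\neq 0$ and $c_{\rm ww}(0)=1$, and for $\kappa>0$ let $c_{\rm ww}^2(\kappa|\partial_z|)$ be the Fourier multiplier on $2\pi$-periodic functions of $z$ given by $e^{inz}\mapsto c_{\rm ww}(\kappa |n|)^2e^{inz}$, $n\in\mathbb Z$. Fix $T\ge 0$ and $\kappa>0$ such that $c_{\rm ww}(\kappa)\neq c_{\rm ww}(n\kappa)$ for all $n=2,3,\dots$ and $c_{\rm ww}(\kappa)\neq 1$. Put $$h_0=\frac34\,\frac{c_{\rm ww}(\kappa)}{c_{\rm ww}^2(\kappa)-1},\qquad h_2=\frac34\,\frac{c_{\rm ww}(\kappa)}{c_{\rm ww}^2(\kappa)-c_{\rm ww}^2(2\kappa)}.$$ Then there are $a_0>0$ and a one-parameter family $(\eta,u,c)(a;\kappa)$, $|a|<a_0$, such that for each such $a$ the functions $\eta(a;\kappa),u(a;\kappa):\mathbb R\to\mathbb R$ are smooth, even and $2\pi$-periodic, $c(a;\kappa)>0$, and $$-c\,\eta+c_{\rm ww}^2(\kappa|\partial_z|)u+u\eta=0,\qquad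 -c\,u+\eta+\tfrac12u^2=0 .$$ Moreover $c(a;\kappa)$ is smooth in $a$, $\eta(a;\kappa)(z)$ and $u(a;\kappa)(z)$ are smooth in $(a,z)$ jointly, and $$\eta(a;\kappa)(z)=a\,c_{\rm ww}(\kappa)\cos z+a^2\Big(c_{\rm ww}(\kappa)h_0-\tfrac14+\big(c_{\rm ww}(\kappa)h_2-\tfrac14\big)\cos 2z\Big)+O(a^3),$$ $$u(a;\kappa)(z)=a\cos z+a^2\big(h_0+h_2\cos 2z\big)+O(a^3),$$ $$c(a;\kappa)=c_{\rm ww}(\kappa)+\tfrac32a^2\Big(h_0+\tfrac12h_2-\frac{1}{8c_{\rm ww}(\kappa)}\Big)+O(a^3)$$ as $a\to0$, where the $O(a^3)$ remainders of $\eta$ and $u$, and each of their $z$-derivatives, are bounded by a constant (depending on $T$, $\kappa$ and the order of the derivative) times $|a|^3$, uniformly in $z\in\mathbb R$ and $|a|<a_0$. -/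

import Mathlib

open scoped ContDiff

noncomputable section

/-- Phase speed of linear gravity-capillary water waves,
`c(k) = √((1 + T k²) tanh k / k)`, extended continuously by `c(0) = 1`. -/
def cww (T k : ℝ) : ℝ :=
  if k = 0 then 1 else Real.sqrt ((1 + T * k ^ 2) * (Real.tanh k / k))

/-- `g = m(∂) f` for the Fourier multiplier with symbol `m` acting on `2π`-periodic functions:
the Fourier series `∑ m(n) f̂(n) e^{inz}` converges to `g z` at every `z`, where
`f̂(n) = (2π)⁻¹ ∫₀^{2π} f(x) e^{-inx} dx`. -/
def IsFourierMultiplierImage (m : ℤ → ℝ) (f g : ℝ → ℝ) : Prop :=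
  ∀ z : ℝ, HasSum
    (fun n : ℤ => (m n : ℂ) * fourierCoeffOn Real.two_pi_pos (fun x => (f x : ℂ)) n
      * Complex.exp (Complex.I * n * z))
    (g z : ℂ)

/-- `(η, u)` is a smooth, even, `2π`-periodic solution with speed `c > 0` of
`-c η + c_ww²(κ|∂_z|) u + u η = 0`, `-c u + η + u² / 2 = 0`. -/
structure IsEvenPeriodicTravelingWave (T κ c : ℝ) (η u : ℝ → ℝ) : Prop where
  speed_pos : 0 < c
  smooth_η : ContDiff ℝ ∞ η
  smooth_u : ContDiff ℝ ∞ u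
  even_η : Function.Even η
  even_u : Function.Even u
  periodic_η : Function.Periodic η (2 * Real.pi)
  periodic_u : Function.Periodic u (2 * Real.pi)
  eq_mass : ∃ w : ℝ → ℝ,
    IsFourierMultiplierImage (fun n : ℤ => cww T (κ * |(n : ℝ)|) ^ 2) u w ∧
      ∀ z, -c * η z + w z + u z * η z = 0
  eq_momentum : ∀ z, -c * u z + η z + 1 / 2 * u z ^ 2 = 0

/-- The coefficient `h₀ = (3/4) c(κ) / (c(κ)² - 1)`. -/
def hZero (T κ : ℝ) : ℝ := 3 / 4 * (cww T κ / (cww T κ ^ 2 - 1))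

/-- The coefficient `h₂ = (3/4) c(κ) / (c(κ)² - c(2κ)²)`. -/
def hTwo (T κ : ℝ) : ℝ := 3 / 4 * (cww T κ / (cww T κ ^ 2 - cww T (2 * κ) ^ 2))

end

/-!
Eliminating `η = c u - u² / 2` leaves the scalar equation `(c² - L) u = 3/2 c u² - 1/2 u³`, where
`L` multiplies `cos (n z)` by `c_ww(κ n)²`. On even functions the nonresonance assumptions make the
kernel of `c₀² - L`, `c₀ = c_ww(κ)`, one-dimensional, spanned by `cos z`, and since `c_ww` tends to
`0` or `∞` the inverse on the complement is bounded on a Banach algebra of cosine series with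
exponentially decaying coefficients, whose elements are smooth. Writing
`u = a (cos z + a H + a² r)` and `c = c₀ + a² l` with `H = h₀ + h₂ cos 2z` cancels the orders `a`
and `a²`; after division by `a³` the equation, split into its component along `cos z` and the
rest, is a fixed-point problem for `(l, r)` whose right-hand side is constant at `a = 0`, so the
implicit function theorem solves it for small `a` without loss of smoothness.
-/

noncomputable section

open Filter Topology

section Fourier

theorem fourierCoeff_of_hasSum {T : ℝ} [Fact (0 < T)] {c : ℤ → ℂ} {f : C(AddCircle T, ℂ)}
    (hf : HasSum (fun n => c n • fourier n) f) : fourierCoeff f = c := by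
  ext n
  let coeffCLM : C(AddCircle T, ℂ) →L[ℂ] ℂ :=
    lp.evalCLM ℂ (fun _ : ℤ => ℂ) 2 n ∘L
      fourierBasis.repr.toContinuousLinearEquiv.toContinuousLinearMap ∘L
      ContinuousMap.toLp 2 AddCircle.haarAddCircle ℂ
  have hcoeff (g : C(AddCircle T, ℂ)) : coeffCLM g = fourierCoeff g n := by
    rw [← fourierCoeff_toLp, ← fourierBasis_repr]
    rfl
  have hsum : HasSum (fun k => if k = n then c n else 0) (fourierCoeff f n) := by
    convert hf.mapL coeffCLM using 1
    · ext k
      rw [map_smul, hcoeff, fourierCoeff_fourier]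
      rcases eq_or_ne k n with rfl | hk
      · simp
      · simp [hk]
    · exact (hcoeff f).symm
  exact hsum.unique (hasSum_ite_eq n (c n))

theorem fourierCoeffOn_of_hasSum {a b : ℝ} (hab : a < b) {c : ℤ → ℂ} {f : ℝ → ℂ}
    (hf : ∀ x : ℝ, HasSum (fun n => c n * fourier n (x : AddCircle (b - a))) (f x)) :
    fourierCoeffOn hab f = c := by
  have : Fact (0 < b - a) := ⟨sub_pos.2 hab⟩
  have hc : Summable fun n => c n • (fourier n : C(AddCircle (b - a), ℂ)) := by
    refine Summable.of_norm ((hf 0).summable.norm.congr fun n => ?_)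
    rw [norm_smul, fourier_norm, norm_mul, fourier_apply, Circle.norm_coe]
  obtain ⟨g, hg⟩ := hc
  have hfg (x : ℝ) : f x = g x :=
    (hf x).unique (by simpa using hg.mapL (ContinuousMap.evalCLM ℂ (x : AddCircle (b - a))))
  ext n
  rw [← fourierCoeff_of_hasSum hg, fourierCoeffOn_eq_integral,
    fourierCoeff_eq_intervalIntegral _ n a, add_sub_cancel]
  simp only [hfg]

/-- The coefficient of `e^{inx}` in the cosine series `∑ a n * cos (n x)`. -/
def cosineFourierCoeff (a : ℕ → ℝ) (n : ℤ) : ℝ := if n = 0 then a 0 else a n.natAbs / 2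

theorem abs_cosineFourierCoeff_le (a : ℕ → ℝ) (n : ℤ) :
    |cosineFourierCoeff a n| ≤ |a n.natAbs| := by
  unfold cosineFourierCoeff
  split_ifs with hn
  · simp [hn]
  · rw [abs_div, abs_two]
    exact half_le_self (abs_nonneg _)

theorem cosineFourierCoeff_add_neg (a : ℕ → ℝ) (n : ℕ) (x : ℝ) :
    cosineFourierCoeff a n * Complex.exp (Complex.I * (n : ℤ) * x) +
        cosineFourierCoeff a (-n) * Complex.exp (Complex.I * (-n : ℤ) * x) =
      (a n * Real.cos (n * x) : ℝ) + if n = 0 then (cosineFourierCoeff a 0 : ℂ) else 0 := by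
  rcases eq_or_ne n 0 with rfl | hn
  · simp [cosineFourierCoeff]
  · have hpos : Complex.I * ((n : ℤ) : ℂ) * x = n * x * Complex.I := by push_cast; ring
    have hneg : Complex.I * ((-n : ℤ) : ℂ) * x = -(n * x) * Complex.I := by push_cast; ring
    simp only [hpos, hneg, cosineFourierCoeff, neg_eq_zero, Int.natCast_eq_zero, hn, if_false,
      Int.natAbs_neg, Int.natAbs_natCast, Complex.ofReal_mul, Complex.ofReal_cos,
      Complex.ofReal_natCast, Complex.cos, Complex.ofReal_div, Complex.ofReal_ofNat]
    ring

theorem hasSum_cosineFourierCoeff {a : ℕ → ℝ} (ha : Summable a) {x y : ℝ}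
    (h : HasSum (fun n : ℕ => a n * Real.cos (n * x)) y) :
    HasSum (fun n : ℤ => cosineFourierCoeff a n * Complex.exp (Complex.I * n * x)) (y : ℂ) := by
  set g : ℤ → ℂ := fun n => cosineFourierCoeff a n * Complex.exp (Complex.I * n * x)
  have hnorm (n : ℤ) : ‖g n‖ ≤ ‖a n.natAbs‖ := by
    have hexp : ‖Complex.exp (Complex.I * n * x)‖ = 1 := by
      rw [mul_assoc, mul_comm]
      exact_mod_cast Complex.norm_exp_ofReal_mul_I (n * x)
    rw [norm_mul, hexp, mul_one, Complex.norm_real]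
    exact abs_cosineFourierCoeff_le a n
  have hpos : Summable fun n : ℕ => g n :=
    .of_norm_bounded ha.norm fun n => by simpa using hnorm n
  have hneg : Summable fun n : ℕ => g (-n) :=
    .of_norm_bounded ha.norm fun n => by simpa using hnorm (-n)
  have hpair : HasSum (fun n : ℕ => g n + g (-n)) (y + g 0) := by
    have h0 : g 0 = cosineFourierCoeff a 0 := by simp [g]
    simp only [g, cosineFourierCoeff_add_neg, h0]
    exact (Complex.hasSum_ofReal.2 h).add (hasSum_ite_eq 0 _)
  have hsum := HasSum.of_nat_of_neg hpos.hasSum hneg.hasSum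
  rwa [← hpair.unique (hpos.hasSum.add hneg.hasSum), add_sub_cancel_right] at hsum

theorem fourierCoeffOn_of_hasSum_cos {a : ℕ → ℝ} {f : ℝ → ℝ}
    (hf : ∀ x, HasSum (fun n : ℕ => a n * Real.cos (n * x)) (f x)) :
    fourierCoeffOn Real.two_pi_pos (fun x => (f x : ℂ)) =
      fun n => (cosineFourierCoeff a n : ℂ) := by
  have ha : Summable a := by simpa using (hf 0).summable
  refine fourierCoeffOn_of_hasSum _ fun x => ?_
  convert hasSum_cosineFourierCoeff ha (hf x) using 3 with n
  rw [fourier_coe_apply, sub_zero]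
  congr 1
  push_cast
  field_simp

theorem isFourierMultiplierImage_of_hasSum_cos (m : ℕ → ℝ) {a : ℕ → ℝ} {f g : ℝ → ℝ}
    (hf : ∀ x, HasSum (fun n : ℕ => a n * Real.cos (n * x)) (f x))
    (hg : ∀ x, HasSum (fun n : ℕ => m n * a n * Real.cos (n * x)) (g x)) :
    IsFourierMultiplierImage (fun n => m n.natAbs) f g := by
  have hma : Summable fun n => m n * a n := by simpa using (hg 0).summable
  intro x
  convert hasSum_cosineFourierCoeff hma (hg x) using 3 with n
  simp only [fourierCoeffOn_of_hasSum_cos hf, cosineFourierCoeff]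
  split_ifs with hn
  · simp [hn]
  · push_cast
    ring

theorem eq_of_hasSum_cos {a b : ℕ → ℝ} {f : ℝ → ℝ}
    (ha : ∀ x, HasSum (fun n : ℕ => a n * Real.cos (n * x)) (f x))
    (hb : ∀ x, HasSum (fun n : ℕ => b n * Real.cos (n * x)) (f x)) : a = b := by
  ext n
  have h := congr_fun
    ((fourierCoeffOn_of_hasSum_cos ha).symm.trans (fourierCoeffOn_of_hasSum_cos hb)) n
  rcases eq_or_ne n 0 with rfl | hn
  · simpa [cosineFourierCoeff] using h
  · simpa [cosineFourierCoeff, hn] using h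

end Fourier

/-- Even periodic functions with exponentially decaying Fourier coefficients: a summable sequence
`f` encodes `z ↦ ∑ f n * 2⁻ⁿ * cos (n z)`. The weight `2ⁿ` on the `n`-th cosine coefficient makes
these functions analytic in a strip. -/
def CosineSeries : Type := lp (fun _ : ℕ => ℝ) 1

namespace CosineSeries

instance : NormedAddCommGroup CosineSeries := inferInstanceAs (NormedAddCommGroup (lp _ 1))

instance : NormedSpace ℝ CosineSeries :=
  inferInstanceAs (NormedSpace ℝ (lp (fun _ : ℕ => ℝ) 1))

instance : CompleteSpace CosineSeries :=
  inferInstanceAs (CompleteSpace (lp (fun _ : ℕ => ℝ) 1))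

/-- The coefficient of `cos (n z)`. -/
def coeff (n : ℕ) : CosineSeries →L[ℝ] ℝ :=
  (1 / 2 : ℝ) ^ n • lp.evalCLM ℝ (fun _ : ℕ => ℝ) 1 n

/-- The function `cos (n z)`. -/
def cosine (n : ℕ) : CosineSeries := lp.single 1 n ((2 : ℝ) ^ n)

theorem coeff_cosine (n k : ℕ) : coeff n (cosine k) = if n = k then 1 else 0 := by
  change (1 / 2 : ℝ) ^ n * lp.single (E := fun _ : ℕ => ℝ) 1 k ((2 : ℝ) ^ k) n = _
  rw [lp.single_apply, Pi.single_apply]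
  split_ifs with h
  · rw [h, ← mul_pow]
    norm_num
  · rw [mul_zero]

theorem norm_cosine (n : ℕ) : ‖cosine n‖ = 2 ^ n :=
  (lp.norm_single zero_lt_one n _).trans (Real.norm_of_nonneg (by positivity))

theorem hasSum_norm (f : CosineSeries) : HasSum (fun n => ‖coeff n f‖ * 2 ^ n) ‖f‖ := by
  have hcoeff (n : ℕ) : ‖coeff n f‖ * 2 ^ n = ‖lp.evalCLM ℝ (fun _ : ℕ => ℝ) 1 n f‖ := by
    change ‖(1 / 2 : ℝ) ^ n * _‖ * 2 ^ n = _
    rw [norm_mul, norm_pow, mul_right_comm, ← mul_pow]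
    norm_num
  have h := lp.hasSum_norm (p := 1) (by simp) (f : lp (fun _ : ℕ => ℝ) 1)
  simp only [ENNReal.toReal_one, Real.rpow_one] at h
  simp only [hcoeff]
  exact h

theorem norm_coeff_le (n : ℕ) : ‖coeff n‖ ≤ (1 / 2) ^ n := by
  refine ContinuousLinearMap.opNorm_le_bound _ (by positivity) fun f => ?_
  rw [one_div, inv_pow, inv_mul_eq_div, le_div_iff₀ (by positivity)]
  exact le_hasSum (hasSum_norm f) n fun k _ => by positivity

theorem hasSum_cosine (f : CosineSeries) : HasSum (fun n => coeff n f • cosine n) f := by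
  have hcoeff (n : ℕ) : coeff n f • cosine n =
      lp.single 1 n (lp.evalCLM ℝ (fun _ : ℕ => ℝ) 1 n f) := by
    change ((1 / 2 : ℝ) ^ n * _) • lp.single (E := fun _ : ℕ => ℝ) 1 n ((2 : ℝ) ^ n) = _
    rw [← lp.single_smul, smul_eq_mul, mul_right_comm, ← mul_pow]
    norm_num
  simp only [hcoeff]
  exact lp.hasSum_single ENNReal.one_ne_top (f : lp (fun _ : ℕ => ℝ) 1)

theorem ext_coeff {f g : CosineSeries} (h : ∀ n, coeff n f = coeff n g) : f = g :=
  (hasSum_cosine f).unique <| by simpa only [h] using hasSum_cosine g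

section Lift

variable {B : Type*} [NormedAddCommGroup B] [NormedSpace ℝ B]

theorem clm_ext {S S' : CosineSeries →L[ℝ] B} (h : ∀ n, S (cosine n) = S' (cosine n)) :
    S = S' := by
  ext f
  refine ((hasSum_cosine f).mapL S).unique ?_
  simpa only [map_smul, h] using (hasSum_cosine f).mapL S'

theorem norm_coeff_smul_le {b : ℕ → B} {K : ℝ} (hb : ∀ n, ‖b n‖ ≤ K * 2 ^ n) (f : CosineSeries)
    (n : ℕ) : ‖coeff n f • b n‖ ≤ K * (‖coeff n f‖ * 2 ^ n) := by
  rw [norm_smul, mul_left_comm]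
  gcongr
  exact hb n

variable [CompleteSpace B]

theorem summable_coeff_smul {b : ℕ → B} {K : ℝ} (hb : ∀ n, ‖b n‖ ≤ K * 2 ^ n) (f : CosineSeries) :
    Summable fun n => coeff n f • b n :=
  .of_norm_bounded ((hasSum_norm f).summable.mul_left K) (norm_coeff_smul_le hb f)

/-- The continuous linear map sending `cos (n z)` to `b n`. -/
def lift (b : ℕ → B) (K : ℝ) (hb : ∀ n, ‖b n‖ ≤ K * 2 ^ n) : CosineSeries →L[ℝ] B :=
  LinearMap.mkContinuous
    { toFun := fun f => ∑' n, coeff n f • b n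
      map_add' := fun f g => by
        simp only [map_add, add_smul]
        exact (summable_coeff_smul hb f).tsum_add (summable_coeff_smul hb g)
      map_smul' := fun c f => by
        simp only [map_smul, smul_assoc]
        exact (summable_coeff_smul hb f).tsum_const_smul c }
    K fun f => tsum_of_norm_bounded ((hasSum_norm f).mul_left K) (norm_coeff_smul_le hb f)

variable {b : ℕ → B} {K : ℝ} (hb : ∀ n, ‖b n‖ ≤ K * 2 ^ n)

theorem hasSum_lift (f : CosineSeries) : HasSum (fun n => coeff n f • b n) (lift b K hb f) :=
  (summable_coeff_smul hb f).hasSum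

theorem norm_lift_le : ‖lift b K hb‖ ≤ K :=
  LinearMap.mkContinuous_norm_le _ (by simpa using (norm_nonneg _).trans (hb 0)) _

theorem lift_cosine (n : ℕ) : lift b K hb (cosine n) = b n := by
  refine (hasSum_lift hb _).unique ?_
  convert hasSum_ite_eq n (b n) using 2 with k
  rw [coeff_cosine]
  split_ifs with h
  · rw [h, one_smul]
  · rw [zero_smul]

end Lift

/-- The value at `z` of the function encoded by a cosine series. -/
def eval (z : ℝ) : CosineSeries →L[ℝ] ℝ :=
  lift (fun n => Real.cos (n * z)) 1 fun n =>
    (Real.abs_cos_le_one _).trans (by rw [one_mul]; exact one_le_pow₀ one_le_two)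

theorem hasSum_eval (z : ℝ) (f : CosineSeries) :
    HasSum (fun n : ℕ => coeff n f * Real.cos (n * z)) (eval z f) :=
  hasSum_lift _ f

theorem eval_cosine (z : ℝ) (n : ℕ) : eval z (cosine n) = Real.cos (n * z) :=
  lift_cosine _ n

theorem eval_neg (z : ℝ) : eval (-z) = eval z :=
  clm_ext fun n => by simp [eval_cosine]

theorem eval_add_two_pi (z : ℝ) : eval (z + 2 * Real.pi) = eval z :=
  clm_ext fun n => by
    rw [eval_cosine, eval_cosine, mul_add, Real.cos_add_nat_mul_two_pi]

theorem ext_eval {f g : CosineSeries} (h : ∀ z, eval z f = eval z g) : f = g :=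
  ext_coeff fun n => congr_fun
    (eq_of_hasSum_cos (fun z => hasSum_eval z f) fun z => by rw [h]; exact hasSum_eval z g) n

section Smoothness

theorem hasSum_cos_smul_coeff (z : ℝ) :
    HasSum (fun n : ℕ => Real.cos (n * z) • coeff n) (eval z) := by
  have hs : Summable fun n : ℕ => Real.cos (n * z) • coeff n := by
    refine .of_norm_bounded summable_geometric_two fun n => ?_
    rw [norm_smul]
    exact (mul_le_of_le_one_left (norm_nonneg _) (Real.abs_cos_le_one _)).trans (norm_coeff_le n)
  convert hs.hasSum
  ext f
  refine (hasSum_eval z f).unique ?_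
  simpa [mul_comm] using hs.hasSum.mapL (ContinuousLinearMap.apply ℝ ℝ f)

theorem norm_iteratedFDeriv_cos_smul_coeff_le (k n : ℕ) (z : ℝ) :
    ‖iteratedFDeriv ℝ k (fun z : ℝ => Real.cos (n * z) • coeff n) z‖ ≤
      (n : ℝ) ^ k * (1 / 2) ^ n := by
  have hcos : ContDiff ℝ k fun z : ℝ => Real.cos (n * z) := by fun_prop
  rw [norm_iteratedFDeriv_eq_norm_iteratedDeriv,
    iteratedDeriv_smul_const hcos.contDiffAt, iteratedDeriv_comp_const_mul Real.contDiff_cos,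
    norm_smul, norm_mul, norm_pow, Real.norm_natCast]
  have hle : ‖iteratedDeriv k Real.cos (n * z)‖ ≤ 1 := Real.abs_iteratedDeriv_cos_le_one _ _
  gcongr
  · exact mul_le_of_le_one_right (by positivity) hle
  · exact norm_coeff_le n

theorem contDiff_eval : ContDiff ℝ ∞ eval := by
  rw [funext fun z => (hasSum_cos_smul_coeff z).tsum_eq.symm]
  exact contDiff_tsum (fun n => by fun_prop)
    (fun k _ => summable_pow_mul_geometric_of_norm_lt_one k (by norm_num))
    fun k n z _ => norm_iteratedFDeriv_cos_smul_coeff_le k n z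

theorem contDiff_eval_apply (f : CosineSeries) : ContDiff ℝ ∞ fun z => eval z f :=
  contDiff_eval.clm_apply contDiff_const

theorem iteratedDeriv_eval (k : ℕ) (f : CosineSeries) (z : ℝ) :
    iteratedDeriv k (fun x => eval x f) z = iteratedDeriv k eval z f := by
  have h := (ContinuousLinearMap.apply ℝ ℝ f).iteratedFDeriv_comp_left
    (contDiff_eval.contDiffAt (x := z)) (i := k) (by exact_mod_cast le_top)
  have := congr_arg (fun φ => φ fun _ => (1 : ℝ)) h
  simpa [iteratedDeriv_eq_iteratedFDeriv, Function.comp_def] using this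

theorem exists_norm_iteratedDeriv_eval_le (k : ℕ) : ∃ K : ℝ, ∀ z, ‖iteratedDeriv k eval z‖ ≤ K := by
  have hperiodic : Function.Periodic (iteratedDeriv k eval) (2 * Real.pi) := fun z => by
    have h := congr_fun (iteratedDeriv_comp_add_const (n := k) (f := eval) (s := 2 * Real.pi)) z
    simp only [eval_add_two_pi] at h
    exact h.symm
  have hcont : Continuous (iteratedDeriv k eval) :=
    contDiff_eval.continuous_iteratedDeriv k (by exact_mod_cast le_top)
  obtain ⟨K, hK⟩ := (hperiodic.isBounded_of_continuous Real.two_pi_pos.ne' hcont).exists_norm_le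
  exact ⟨K, fun z => hK _ ⟨z, rfl⟩⟩

theorem exists_abs_iteratedDeriv_eval_le (k : ℕ) :
    ∃ K : ℝ, ∀ (f : CosineSeries) (z : ℝ), |iteratedDeriv k (fun x => eval x f) z| ≤ K * ‖f‖ := by
  obtain ⟨K, hK⟩ := exists_norm_iteratedDeriv_eval_le k
  refine ⟨K, fun f z => ?_⟩
  rw [iteratedDeriv_eval, ← Real.norm_eq_abs]
  exact (iteratedDeriv k eval z).le_of_opNorm_le (hK z) f

theorem contDiffOn_eval_prod {E : Type*} [NormedAddCommGroup E] [NormedSpace ℝ E] {s : Set E}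
    {f : E → CosineSeries} (hf : ContDiffOn ℝ ∞ f s) :
    ContDiffOn ℝ ∞ (fun p : E × ℝ => eval p.2 (f p.1)) (s ×ˢ Set.univ) :=
  (contDiff_eval.comp contDiff_snd).contDiffOn.clm_apply
    (hf.comp contDiffOn_fst fun _ hp => hp.1)

end Smoothness

section Multiplier

variable (m : ℕ → ℝ) {K : ℝ} (hm : ∀ n, |m n| ≤ K)

/-- The Fourier multiplier with symbol `m`, where `m` is bounded by `K`. -/
def multiplier : CosineSeries →L[ℝ] CosineSeries :=
  lift (fun n => m n • cosine n) K fun n => by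
    rw [norm_smul, norm_cosine]
    exact mul_le_mul_of_nonneg_right (hm n) (by positivity)

theorem coeff_multiplier (f : CosineSeries) (n : ℕ) :
    coeff n (multiplier m hm f) = m n * coeff n f := by
  have h : (coeff n).comp (multiplier m hm) = m n • coeff n := clm_ext fun k => by
    rw [ContinuousLinearMap.comp_apply, multiplier, lift_cosine, map_smul,
      smul_apply, coeff_cosine]
    split_ifs with hnk <;> simp [hnk]
  exact DFunLike.congr_fun h f

end Multiplier

section Algebra

theorem norm_half_smul_cosine_add_le (k l : ℕ) :
    ‖(1 / 2 : ℝ) • (cosine (k + l) + cosine (Nat.dist k l))‖ ≤ 2 ^ k * 2 ^ l := by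
  have hdist : (2 : ℝ) ^ Nat.dist k l ≤ 2 ^ (k + l) :=
    pow_le_pow_right₀ one_le_two (by unfold Nat.dist; omega)
  calc ‖(1 / 2 : ℝ) • (cosine (k + l) + cosine (Nat.dist k l))‖
      ≤ 1 / 2 * (2 ^ (k + l) + 2 ^ Nat.dist k l) := by
        rw [norm_smul, Real.norm_of_nonneg one_half_pos.le, ← norm_cosine, ← norm_cosine]
        gcongr
        exact norm_add_le _ _
    _ ≤ 2 ^ k * 2 ^ l := by
        rw [← pow_add]
        linarith

/-- Pointwise multiplication of even periodic functions, given on cosines by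
`cos (k z) cos (l z) = (cos ((k + l) z) + cos ((k - l) z)) / 2`. -/
def mulCLM : CosineSeries →L[ℝ] CosineSeries →L[ℝ] CosineSeries :=
  lift (fun k => lift _ (2 ^ k) (norm_half_smul_cosine_add_le k)) 1 fun _ =>
    (norm_lift_le _).trans_eq (one_mul _).symm

theorem mulCLM_cosine (k l : ℕ) :
    mulCLM (cosine k) (cosine l) = (1 / 2 : ℝ) • (cosine (k + l) + cosine (Nat.dist k l)) := by
  rw [mulCLM, lift_cosine, lift_cosine]

theorem eval_mulCLM (z : ℝ) (f g : CosineSeries) :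
    eval z (mulCLM f g) = eval z f * eval z g := by
  have h : (ContinuousLinearMap.compL ℝ _ _ _ (eval z)).comp mulCLM =
      (ContinuousLinearMap.mul ℝ ℝ).bilinearComp (eval z) (eval z) :=
    clm_ext fun k => clm_ext fun l => by
      have hdist : Real.cos (Nat.dist k l * z) = Real.cos (k * z - l * z) := by
        rcases le_total k l with hkl | hkl
        · rw [Nat.dist_eq_sub_of_le hkl, Nat.cast_sub hkl, ← Real.cos_neg]
          ring_nf
        · rw [Nat.dist_eq_sub_of_le_right hkl, Nat.cast_sub hkl, sub_mul]
      simp [mulCLM_cosine, eval_cosine, hdist, add_mul, Real.cos_add, Real.cos_sub]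
      ring
  exact DFunLike.congr_fun (DFunLike.congr_fun h f) g

instance : One CosineSeries := ⟨cosine 0⟩

instance : Mul CosineSeries := ⟨fun f g => mulCLM f g⟩

theorem eval_mul (z : ℝ) (f g : CosineSeries) : eval z (f * g) = eval z f * eval z g :=
  eval_mulCLM z f g

theorem eval_one (z : ℝ) : eval z 1 = 1 :=
  (eval_cosine z 0).trans (by simp)

theorem cosine_mul_cosine (k l : ℕ) :
    cosine k * cosine l = (1 / 2 : ℝ) • (cosine (k + l) + cosine (Nat.dist k l)) :=
  mulCLM_cosine k l

instance : NormedCommRing CosineSeries where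
  __ := (inferInstance : NormedAddCommGroup CosineSeries)
  left_distrib f g h := map_add (mulCLM f) g h
  right_distrib f g h := by
    refine ext_eval fun z => ?_
    simp only [eval_mul, map_add, add_mul]
  zero_mul f := by
    refine ext_eval fun z => ?_
    rw [eval_mul, map_zero, zero_mul]
  mul_zero f := map_zero (mulCLM f)
  mul_assoc f g h := by
    refine ext_eval fun z => ?_
    simp only [eval_mul, mul_assoc]
  one_mul f := by
    refine ext_eval fun z => ?_
    rw [eval_mul, eval_one, one_mul]
  mul_one f := by
    refine ext_eval fun z => ?_
    rw [eval_mul, eval_one, mul_one]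
  mul_comm f g := by
    refine ext_eval fun z => ?_
    rw [eval_mul, eval_mul, mul_comm]
  norm_mul_le f g := by
    refine (mulCLM.le_opNorm₂ f g).trans ?_
    rw [mul_assoc]
    exact mul_le_of_le_one_left (by positivity) (norm_lift_le _)

instance : NormedAlgebra ℝ CosineSeries where
  __ := Algebra.ofModule
    (fun c f g => ext_eval fun z => by
      simp only [eval_mul, map_smul, smul_eq_mul, mul_assoc])
    (fun c f g => ext_eval fun z => by
      simp only [eval_mul, map_smul, smul_eq_mul, mul_left_comm])
  norm_smul_le := norm_smul_le

theorem eval_pow (z : ℝ) (f : CosineSeries) (n : ℕ) : eval z (f ^ n) = eval z f ^ n := by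
  induction n with
  | zero => rw [pow_zero, pow_zero, eval_one]
  | succ n ih => rw [pow_succ, pow_succ, eval_mul, ih]

end Algebra

end CosineSeries

section Bifurcation

theorem exists_contDiffAt_fixedPoint {𝕜 X Y : Type*} [RCLike 𝕜]
    [NormedAddCommGroup X] [NormedSpace 𝕜 X] [CompleteSpace X]
    [NormedAddCommGroup Y] [NormedSpace 𝕜 Y] [CompleteSpace Y] {n : WithTop ℕ∞} (hn : n ≠ 0)
    {Ψ : X × Y → Y} {x₀ : X} {y₀ : Y} (hΨ : ContDiffAt 𝕜 n Ψ (x₀, y₀))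
    (hconst : ∀ y, Ψ (x₀, y) = y₀) :
    ∃ φ : X → Y, φ x₀ = y₀ ∧ ContDiffAt 𝕜 n φ x₀ ∧ ∀ᶠ x in 𝓝 x₀, Ψ (x, φ x) = φ x := by
  set F : X × Y → Y := fun p => p.2 - Ψ p with hF
  have hFdiff : ContDiffAt 𝕜 n F (x₀, y₀) := contDiffAt_snd.sub hΨ
  have hpartial : fderiv 𝕜 F (x₀, y₀) ∘L .inr 𝕜 X Y = ContinuousLinearMap.id 𝕜 Y := by
    have hcomp := (hFdiff.differentiableAt hn).hasFDerivAt.comp y₀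
      (hasFDerivAt_prodMk_right x₀ y₀)
    have hfibre : F ∘ (fun y : Y => (x₀, y)) = fun y => y - y₀ := by
      ext y
      simp [hF, hconst]
    rw [hfibre] at hcomp
    exact hcomp.unique ((hasFDerivAt_id y₀).sub_const y₀)
  have hinv : (fderiv 𝕜 F (x₀, y₀) ∘L .inr 𝕜 X Y).IsInvertible :=
    hpartial ▸ ⟨.refl 𝕜 Y, rfl⟩
  refine ⟨hFdiff.implicitFunction hn hinv, hFdiff.implicitFunction_apply_self hn hinv,
    hFdiff.contDiffAt_implicitFunction hn hinv, ?_⟩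
  filter_upwards [hFdiff.eventually_apply_implicitFunction hn hinv] with x hx
  simp only [hF, hconst, sub_self] at hx
  exact (sub_eq_zero.1 hx).symm

variable {A : Type*} [NormedCommRing A] [NormedAlgebra ℝ A]

/-- The expansion `x + a H + a² r` of a small wave divided by its amplitude `a`. -/
def waveProfile (x H : A) (a : ℝ) (r : A) : A := x + a • H + a ^ 2 • r

/-- The nonlinearity of the scalar equation `(c² - L) u = 3/2 c u² - 1/2 u³` that remains after
eliminating `η = c u - u² / 2`, where `L` is the dispersion operator. -/
def waveNonlinearity (c : ℝ) (u : A) : A := (3 / 2 * c) • u ^ 2 - (1 / 2 : ℝ) • u ^ 3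

/-- The right-hand side of the equation `(c₀² - L) r = waveResidual` for the remainder `r` when
`u = a x + a² H + a³ r` is to solve `(c² - L) u = waveNonlinearity c u` with `c = c₀ + a² l`,
given that `(c₀² - L) x = 0` and `(c₀² - L) H = 3/2 c₀ x²`. -/
def waveResidual (c₀ : ℝ) (x H : A) (a l : ℝ) (r : A) : A :=
  -(2 * c₀ * l + a ^ 2 * l ^ 2) • waveProfile x H a r
    + (3 / 2 * c₀) • ((2 : ℝ) • (x * (H + a • r)) + a • (H + a • r) ^ 2)
    + (3 / 2 * (a * l)) • waveProfile x H a r ^ 2 - (1 / 2 : ℝ) • waveProfile x H a r ^ 3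

theorem waveNonlinearity_smul_waveProfile (c₀ : ℝ) (x H : A) (a l : ℝ) (r : A) :
    waveNonlinearity (c₀ + a ^ 2 * l) (a • waveProfile x H a r) =
      ((c₀ + a ^ 2 * l) ^ 2 - c₀ ^ 2) • a • waveProfile x H a r
        + a ^ 2 • (3 / 2 * c₀) • x ^ 2 + a ^ 3 • waveResidual c₀ x H a l r := by
  simp only [waveNonlinearity, waveProfile, waveResidual, Algebra.smul_def, map_add, map_sub,
    map_neg, map_mul, map_pow, map_ofNat]
  ring

theorem contDiffOn_smul_waveProfile (x H : A) {n : WithTop ℕ∞} {s : Set ℝ} {r : ℝ → A}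
    (hr : ContDiffOn ℝ n r s) : ContDiffOn ℝ n (fun a => a • waveProfile x H a (r a)) s := by
  unfold waveProfile
  fun_prop

theorem contDiff_waveResidual (c₀ : ℝ) (x H : A) :
    ContDiff ℝ ω fun p : ℝ × ℝ × A => waveResidual c₀ x H p.1 p.2.1 p.2.2 := by
  unfold waveResidual waveProfile
  fun_prop

theorem waveResidual_zero (c₀ : ℝ) (x H : A) (l : ℝ) (r : A) :
    waveResidual c₀ x H 0 l r =
      -(2 * c₀ * l) • x + ((3 * c₀) • (x * H) - (1 / 2 : ℝ) • x ^ 3) := by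
  simp only [waveResidual, waveProfile, zero_smul, add_zero, smul_smul, ne_eq, OfNat.ofNat_ne_zero,
    not_false_eq_true, zero_pow, zero_mul, mul_zero]
  rw [show 3 / 2 * c₀ * 2 = 3 * c₀ by ring, add_sub_assoc]

/-- Lyapunov-Schmidt reduction: `P` is the projection to the kernel direction `x` of `c₀² - L`, and
`G` is the inverse of `c₀² - L` on the complement, extended by zero. -/
theorem exists_waveResidual_branch [CompleteSpace A] {c₀ : ℝ} (hc₀ : c₀ ≠ 0) {x : A} (H : A)
    {P : A →L[ℝ] ℝ} (hP : P x = 1) {G : A →L[ℝ] A} (hG : G x = 0) :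
    ∃ (l : ℝ → ℝ) (r : ℝ → A), ContDiffAt ℝ ω l 0 ∧ ContDiffAt ℝ ω r 0 ∧
      l 0 = P ((3 * c₀) • (x * H) - (1 / 2 : ℝ) • x ^ 3) / (2 * c₀) ∧
      ∀ᶠ a in 𝓝 0, P (waveResidual c₀ x H a (l a) (r a)) = 0 ∧
        G (waveResidual c₀ x H a (l a) (r a)) = r a := by
  set N : A := (3 * c₀) • (x * H) - (1 / 2 : ℝ) • x ^ 3
  let Ψ : ℝ × ℝ × A → ℝ × A := fun p =>
    (p.2.1 + P (waveResidual c₀ x H p.1 p.2.1 p.2.2) / (2 * c₀),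
      G (waveResidual c₀ x H p.1 p.2.1 p.2.2))
  have hΨ : ContDiff ℝ ω Ψ := by
    have := contDiff_waveResidual c₀ x H
    fun_prop
  have hzero (l : ℝ) (r : A) : waveResidual c₀ x H 0 l r = -(2 * c₀ * l) • x + N :=
    waveResidual_zero c₀ x H l r
  have hconst (y : ℝ × A) : Ψ (0, y) = (P N / (2 * c₀), G N) := by
    ext
    · simp only [Ψ, hzero, map_add, map_smul, hP, smul_eq_mul]
      field_simp
      ring
    · simp [Ψ, hzero, hG]
  obtain ⟨φ, hφ0, hφ, hfix⟩ := exists_contDiffAt_fixedPoint (by simp) hΨ.contDiffAt hconst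
  refine ⟨fun a => (φ a).1, fun a => (φ a).2, hφ.fst, hφ.snd, congr_arg Prod.fst hφ0, ?_⟩
  filter_upwards [hfix] with a ha
  have hfst : (φ a).1 + P (waveResidual c₀ x H a (φ a).1 (φ a).2) / (2 * c₀) = (φ a).1 :=
    congr_arg Prod.fst ha
  exact ⟨by simpa [hc₀] using hfst, congr_arg Prod.snd ha⟩

end Bifurcation

section Dispersion

theorem tanh_pos_of_pos {x : ℝ} (hx : 0 < x) : 0 < Real.tanh x := by
  rw [Real.tanh_eq_sinh_div_cosh]
  exact div_pos (Real.sinh_pos_iff.2 hx) (Real.cosh_pos x)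

theorem monotone_tanh : Monotone Real.tanh := fun x y hxy => by
  rwa [← Real.artanh_tanh x, ← Real.artanh_tanh y,
    Real.artanh_le_artanh_iff ⟨Real.neg_one_lt_tanh x, Real.tanh_lt_one x⟩
      ⟨Real.neg_one_lt_tanh y, Real.tanh_lt_one y⟩] at hxy

theorem cww_zero (T : ℝ) : cww T 0 = 1 := if_pos rfl

theorem cww_nonneg (T k : ℝ) : 0 ≤ cww T k := by
  unfold cww
  split_ifs
  · exact zero_le_one
  · exact Real.sqrt_nonneg _

theorem cww_pos {T k : ℝ} (hT : 0 ≤ T) (hk : 0 < k) : 0 < cww T k := by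
  rw [cww, if_neg hk.ne', Real.sqrt_pos]
  have := tanh_pos_of_pos hk
  positivity

theorem cww_sq {T k : ℝ} (hT : 0 ≤ T) (hk : 0 < k) :
    cww T k ^ 2 = (1 + T * k ^ 2) * (Real.tanh k / k) := by
  rw [cww, if_neg hk.ne', Real.sq_sqrt]
  have := tanh_pos_of_pos hk
  positivity

theorem tendsto_cww_zero_sq : Tendsto (fun k => cww 0 k ^ 2) atTop (𝓝 0) := by
  refine squeeze_zero' (.of_forall fun _ => sq_nonneg _) ?_ tendsto_inv_atTop_zero
  filter_upwards [eventually_gt_atTop 0] with k hk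
  rw [cww_sq le_rfl hk, zero_mul, add_zero, one_mul, div_eq_mul_inv]
  exact mul_le_of_le_one_left (by positivity) (Real.tanh_lt_one k).le

theorem tendsto_cww_sq_atTop {T : ℝ} (hT : 0 < T) :
    Tendsto (fun k => cww T k ^ 2) atTop atTop := by
  have htanh := tanh_pos_of_pos one_pos
  refine tendsto_atTop_mono' _ ?_ (tendsto_id.const_mul_atTop (mul_pos hT htanh))
  filter_upwards [eventually_ge_atTop 1] with k hk
  have hk0 : 0 < k := one_pos.trans_le hk
  have htanhk := tanh_pos_of_pos hk0
  rw [cww_sq hT.le hk0, id]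
  calc T * Real.tanh 1 * k ≤ T * Real.tanh k * k := by
        gcongr
        exact monotone_tanh hk
    _ = T * k ^ 2 * (Real.tanh k / k) := by field_simp
    _ ≤ (1 + T * k ^ 2) * (Real.tanh k / k) := by
        gcongr
        exact le_add_of_nonneg_left zero_le_one

theorem exists_abs_inv_sub_cww_sq_le {T κ c : ℝ} (hT : 0 ≤ T) (hκ : 0 < κ) (hc : c ≠ 0) :
    ∃ K : ℝ, ∀ n : ℕ, |(c ^ 2 - cww T (κ * n) ^ 2)⁻¹| ≤ K := by
  have hfreq : Tendsto (fun n : ℕ => κ * (n : ℝ)) atTop atTop :=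
    tendsto_natCast_atTop_atTop.const_mul_atTop hκ
  have hlim : ∃ y, Tendsto (fun n : ℕ => (c ^ 2 - cww T (κ * n) ^ 2)⁻¹) atTop (𝓝 y) := by
    rcases hT.eq_or_lt with rfl | hT
    · exact ⟨(c ^ 2 - 0)⁻¹, ((tendsto_cww_zero_sq.comp hfreq).const_sub _).inv₀ (by simpa)⟩
    · exact ⟨0, tendsto_inv_atBot_zero.comp <| tendsto_atBot_add_const_left _ _ <|
        tendsto_neg_atTop_atBot.comp <| (tendsto_cww_sq_atTop hT).comp hfreq⟩
  obtain ⟨y, hy⟩ := hlim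
  obtain ⟨K, hK⟩ := (Metric.isBounded_range_of_tendsto _ hy).exists_norm_le
  exact ⟨K, fun n => hK _ ⟨n, rfl⟩⟩

theorem sub_cww_sq_ne_zero {T κ : ℝ} (hres : ∀ n : ℕ, 2 ≤ n → cww T κ ≠ cww T (n * κ))
    (hone : cww T κ ≠ 1) {n : ℕ} (hn : n ≠ 1) : cww T κ ^ 2 - cww T (κ * n) ^ 2 ≠ 0 := by
  rw [sub_ne_zero, Ne, sq_eq_sq₀ (cww_nonneg _ _) (cww_nonneg _ _), mul_comm]
  obtain rfl | hn : n = 0 ∨ 2 ≤ n := by omega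
  · rwa [Nat.cast_zero, zero_mul, cww_zero]
  · exact hres n hn

end Dispersion

section TravelingWave

open CosineSeries

/-- The elevation `η = c u - u² / 2` determined by the velocity `u`. -/
def elevation (c : ℝ) (u : CosineSeries) : CosineSeries := c • u - (1 / 2 : ℝ) • u ^ 2

theorem eval_elevation (z c : ℝ) (u : CosineSeries) :
    eval z (elevation c u) = c * eval z u - 1 / 2 * eval z u ^ 2 := by
  simp only [elevation, map_sub, map_smul, eval_pow, smul_eq_mul]

theorem contDiffOn_elevation {E : Type*} [NormedAddCommGroup E] [NormedSpace ℝ E] {s : Set E}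
    {n : WithTop ℕ∞} {c : E → ℝ} {u : E → CosineSeries} (hc : ContDiffOn ℝ n c s)
    (hu : ContDiffOn ℝ n u s) : ContDiffOn ℝ n (fun x => elevation (c x) (u x)) s := by
  unfold elevation
  fun_prop

variable {T κ : ℝ}

theorem isEvenPeriodicTravelingWave_of_coeff {c : ℝ} {u : CosineSeries} (hc : 0 < c)
    (hu : ∀ n : ℕ, (c ^ 2 - cww T (κ * n) ^ 2) * coeff n u = coeff n (waveNonlinearity c u)) :
    IsEvenPeriodicTravelingWave T κ c (fun z => eval z (elevation c u)) fun z => eval z u where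
  speed_pos := hc
  smooth_η := contDiff_eval_apply _
  smooth_u := contDiff_eval_apply _
  even_η z := by simp only [eval_neg]
  even_u z := by simp only [eval_neg]
  periodic_η z := by simp only [eval_add_two_pi]
  periodic_u z := by simp only [eval_add_two_pi]
  eq_mass := by
    have hcoeff (n : ℕ) : cww T (κ * n) ^ 2 * coeff n u =
        coeff n (c ^ 2 • u - waveNonlinearity c u) := by
      rw [map_sub, map_smul, smul_eq_mul, ← hu]
      ring
    refine ⟨fun z => eval z (c ^ 2 • u - waveNonlinearity c u), ?_, fun z => ?_⟩
    · have h := isFourierMultiplierImage_of_hasSum_cos (fun n => cww T (κ * n) ^ 2)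
        (fun z => hasSum_eval z u) (g := fun z => eval z (c ^ 2 • u - waveNonlinearity c u))
        fun z => by simpa only [hcoeff] using hasSum_eval z _
      simpa only [Nat.cast_natAbs, Int.cast_abs] using h
    · simp only [eval_elevation, waveNonlinearity, map_sub, map_smul, eval_pow, smul_eq_mul]
      ring
  eq_momentum z := by
    rw [eval_elevation]
    ring

/-- The second-order profile `h₀ + h₂ cos 2z` of the velocity. -/
def secondProfile (T κ : ℝ) : CosineSeries := hZero T κ • cosine 0 + hTwo T κ • cosine 2

theorem eval_secondProfile (z : ℝ) :
    eval z (secondProfile T κ) = hZero T κ + hTwo T κ * Real.cos (2 * z) := by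
  simp [secondProfile, eval_cosine]

theorem sub_cww_sq_mul_coeff_secondProfile
    (hnr : ∀ n : ℕ, n ≠ 1 → cww T κ ^ 2 - cww T (κ * n) ^ 2 ≠ 0) (n : ℕ) :
    (cww T κ ^ 2 - cww T (κ * n) ^ 2) * coeff n (secondProfile T κ) =
      coeff n ((3 / 2 * cww T κ) • cosine 1 ^ 2) := by
  have hsq : cosine 1 ^ 2 = (1 / 2 : ℝ) • (cosine 2 + cosine 0) :=
    (sq _).trans (cosine_mul_cosine 1 1)
  simp only [hsq, secondProfile, map_add, map_smul, smul_eq_mul, coeff_cosine]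
  rcases eq_or_ne n 0 with rfl | hn0
  · have h0 := hnr 0 (by norm_num)
    simp only [Nat.cast_zero, mul_zero, cww_zero, one_pow] at h0 ⊢
    norm_num [hZero]
    field_simp
    norm_num
  rcases eq_or_ne n 2 with rfl | hn2
  · have h2 := hnr 2 (by norm_num)
    simp only [Nat.cast_ofNat, mul_comm κ 2] at h2 ⊢
    norm_num [hTwo]
    field_simp
    norm_num
  · simp [hn0, hn2]

theorem coeff_one_cubic_terms (c₀ : ℝ) :
    coeff 1 ((3 * c₀) • (cosine 1 * secondProfile T κ) - (1 / 2 : ℝ) • cosine 1 ^ 3) =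
      3 * c₀ * (hZero T κ + 1 / 2 * hTwo T κ) - 3 / 8 := by
  simp only [secondProfile, pow_succ, pow_zero, one_mul, mul_add, add_mul, mul_smul_comm,
    smul_mul_assoc, cosine_mul_cosine, map_sub, map_add, map_smul, smul_eq_mul, coeff_cosine]
  norm_num [Nat.dist]
  ring

theorem coeff_wave_equation
    (hnr : ∀ n : ℕ, n ≠ 1 → cww T κ ^ 2 - cww T (κ * n) ^ 2 ≠ 0) {a l : ℝ} {r : CosineSeries}
    (hr : ∀ n : ℕ, (cww T κ ^ 2 - cww T (κ * n) ^ 2) * coeff n r =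
      coeff n (waveResidual (cww T κ) (cosine 1) (secondProfile T κ) a l r)) (n : ℕ) :
    ((cww T κ + a ^ 2 * l) ^ 2 - cww T (κ * n) ^ 2) *
        coeff n (a • waveProfile (cosine 1) (secondProfile T κ) a r) =
      coeff n (waveNonlinearity (cww T κ + a ^ 2 * l)
        (a • waveProfile (cosine 1) (secondProfile T κ) a r)) := by
  have hkernel : (cww T κ ^ 2 - cww T (κ * n) ^ 2) * coeff n (cosine 1) = 0 := by
    rw [coeff_cosine]
    split_ifs with hn
    · rw [hn, Nat.cast_one, mul_one, mul_one, sub_self]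
    · rw [mul_zero]
  have hsecond := sub_cww_sq_mul_coeff_secondProfile hnr n
  rw [waveNonlinearity_smul_waveProfile]
  simp only [map_add, map_smul (coeff n) (a ^ 2), map_smul (coeff n) (a ^ 3), ← hsecond, ← hr]
  simp only [waveProfile, map_add, map_smul, smul_eq_mul]
  linear_combination a * hkernel

theorem exists_wave_branch (hT : 0 ≤ T) (hκ : 0 < κ)
    (hnr : ∀ n : ℕ, n ≠ 1 → cww T κ ^ 2 - cww T (κ * n) ^ 2 ≠ 0) :
    ∃ (l : ℝ → ℝ) (r : ℝ → CosineSeries), ContDiffAt ℝ ω l 0 ∧ ContDiffAt ℝ ω r 0 ∧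
      l 0 = 3 / 2 * (hZero T κ + 1 / 2 * hTwo T κ - 1 / (8 * cww T κ)) ∧
      ∀ᶠ a in 𝓝 0, ∀ n : ℕ, (cww T κ ^ 2 - cww T (κ * n) ^ 2) * coeff n (r a) =
        coeff n (waveResidual (cww T κ) (cosine 1) (secondProfile T κ) a (l a) (r a)) := by
  have hc₀ : cww T κ ≠ 0 := (cww_pos hT hκ).ne'
  obtain ⟨K, hK⟩ := exists_abs_inv_sub_cww_sq_le hT hκ hc₀
  -- The convention `0⁻¹ = 0` at the resonant frequency `n = 1` makes `G` vanish on the kernel.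
  let G : CosineSeries →L[ℝ] CosineSeries := multiplier _ hK
  have hG : G (cosine 1) = 0 := ext_coeff fun n => by
    rw [coeff_multiplier, coeff_cosine, map_zero]
    split_ifs with hn
    · simp [hn]
    · rw [mul_zero]
  obtain ⟨l, r, hl, hr, hl0, hlr⟩ :=
    exists_waveResidual_branch hc₀ (secondProfile T κ) (P := coeff 1) (by simp [coeff_cosine]) hG
  refine ⟨l, r, hl, hr, ?_, ?_⟩
  · rw [hl0, coeff_one_cubic_terms]
    field_simp
  · filter_upwards [hlr] with a ⟨hP, hGr⟩ n
    rcases eq_or_ne n 1 with rfl | hn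
    · rw [hP, Nat.cast_one, mul_one, sub_self, zero_mul]
    · rw [← hGr, coeff_multiplier, hGr, mul_inv_cancel_left₀ (hnr n hn)]

theorem exists_wave_family (hT : 0 ≤ T) (hκ : 0 < κ)
    (hnr : ∀ n : ℕ, n ≠ 1 → cww T κ ^ 2 - cww T (κ * n) ^ 2 ≠ 0) :
    ∃ (a₀ : ℝ) (l : ℝ → ℝ) (r : ℝ → CosineSeries), 0 < a₀ ∧
      ContDiffOn ℝ ∞ l (Set.Icc (-a₀) a₀) ∧ ContDiffOn ℝ ∞ r (Set.Icc (-a₀) a₀) ∧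
      l 0 = 3 / 2 * (hZero T κ + 1 / 2 * hTwo T κ - 1 / (8 * cww T κ)) ∧
      ∀ a ∈ Set.Icc (-a₀) a₀, IsEvenPeriodicTravelingWave T κ (cww T κ + a ^ 2 * l a)
        (fun z => eval z (elevation (cww T κ + a ^ 2 * l a)
          (a • waveProfile (cosine 1) (secondProfile T κ) a (r a))))
        fun z => eval z (a • waveProfile (cosine 1) (secondProfile T κ) a (r a)) := by
  obtain ⟨l, r, hl, hr, hl0, hlr⟩ := exists_wave_branch hT hκ hnr
  have hspeed : ∀ᶠ a in 𝓝 (0 : ℝ), 0 < cww T κ + a ^ 2 * l a := by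
    have := hl.continuousAt
    have hcont : ContinuousAt (fun a => cww T κ + a ^ 2 * l a) 0 := by fun_prop
    exact hcont.eventually_const_lt (by simpa using cww_pos hT hκ)
  have hsmooth := (hl.eventually (by simp)).and (hr.eventually (by simp))
  obtain ⟨a₀, ha₀, hball⟩ := Metric.nhds_basis_closedBall.eventually_iff.1
    (hsmooth.and (hspeed.and hlr))
  rw [Real.closedBall_eq_Icc, zero_sub, zero_add] at hball
  exact ⟨a₀, l, r, ha₀,
    fun a ha => ((hball ha).1.1.of_le le_top).contDiffWithinAt,
    fun a ha => ((hball ha).1.2.of_le le_top).contDiffWithinAt, hl0,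
    fun a ha => isEvenPeriodicTravelingWave_of_coeff (hball ha).2.1
      (coeff_wave_equation hnr (hball ha).2.2)⟩

end TravelingWave

section Remainders

open CosineSeries

variable {T κ : ℝ}

theorem eval_smul_waveProfile_sub (a : ℝ) (r : CosineSeries) (z : ℝ) :
    eval z (a • waveProfile (cosine 1) (secondProfile T κ) a r) -
        (a * Real.cos z + a ^ 2 * (hZero T κ + hTwo T κ * Real.cos (2 * z))) =
      eval z (a ^ 3 • r) := by
  simp only [waveProfile, map_add, map_smul, smul_eq_mul, eval_cosine, Nat.cast_one, one_mul,
    eval_secondProfile]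
  ring

/-- The remainder of `η = c u - u² / 2` beyond second order in `a`, divided by `a³`, where
`c = c₀ + a² l` and `u = a x + a² H + a³ r`. -/
def elevationRemainder (c₀ : ℝ) (x H : CosineSeries) (a l : ℝ) (r : CosineSeries) :
    CosineSeries :=
  c₀ • r + l • waveProfile x H a r - x * (H + a • r) - (a / 2) • (H + a • r) ^ 2

theorem continuousOn_elevationRemainder (c₀ : ℝ) (x H : CosineSeries) {s : Set ℝ} {l : ℝ → ℝ}
    {r : ℝ → CosineSeries} (hl : ContinuousOn l s) (hr : ContinuousOn r s) :
    ContinuousOn (fun a => elevationRemainder c₀ x H a (l a) (r a)) s := by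
  unfold elevationRemainder waveProfile
  fun_prop

theorem eval_elevation_smul_waveProfile_sub (c₀ a l : ℝ) (r : CosineSeries) (z : ℝ) :
    eval z (elevation (c₀ + a ^ 2 * l) (a • waveProfile (cosine 1) (secondProfile T κ) a r)) -
        (a * c₀ * Real.cos z + a ^ 2 * (c₀ * hZero T κ - 1 / 4 +
          (c₀ * hTwo T κ - 1 / 4) * Real.cos (2 * z))) =
      eval z (a ^ 3 • elevationRemainder c₀ (cosine 1) (secondProfile T κ) a l r) := by
  simp only [eval_elevation, elevationRemainder, waveProfile, map_sub, map_add, map_smul,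
    eval_mul, eval_pow, smul_eq_mul, eval_cosine, Nat.cast_one, one_mul, eval_secondProfile,
    Real.cos_two_mul]
  ring

theorem exists_abs_iteratedDeriv_eval_cube_smul_le {a₀ : ℝ} {f : ℝ → CosineSeries}
    (hf : ContinuousOn f (Set.Icc (-a₀) a₀)) (k : ℕ) :
    ∃ C : ℝ, ∀ a : ℝ, |a| < a₀ → ∀ z : ℝ,
      |iteratedDeriv k (fun x => eval x (a ^ 3 • f a)) z| ≤ C * |a| ^ 3 := by
  obtain ⟨K, hK⟩ := exists_abs_iteratedDeriv_eval_le k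
  obtain ⟨B, hB⟩ := isCompact_Icc.exists_bound_of_continuousOn hf
  have hK0 : 0 ≤ K := by
    simpa [norm_cosine] using (abs_nonneg _).trans (hK (cosine 0) 0)
  refine ⟨K * B, fun a ha z => ?_⟩
  calc |iteratedDeriv k (fun x => eval x (a ^ 3 • f a)) z| ≤ K * (|a| ^ 3 * ‖f a‖) := by
        rw [← abs_pow, ← Real.norm_eq_abs (a ^ 3), ← norm_smul]
        exact hK _ z
    _ ≤ K * (|a| ^ 3 * B) := by
        gcongr
        exact hB a (abs_le.1 ha.le)
    _ = K * B * |a| ^ 3 := by ring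

theorem exists_abs_sq_mul_sub_le {a₀ : ℝ} (ha₀ : 0 ≤ a₀) {l : ℝ → ℝ}
    (hl : ContDiffOn ℝ ∞ l (Set.Icc (-a₀) a₀)) :
    ∃ C : ℝ, ∀ a : ℝ, |a| < a₀ → |a ^ 2 * (l a - l 0)| ≤ C * |a| ^ 3 := by
  obtain ⟨K, hK⟩ := hl.exists_lipschitzOnWith (by simp) (convex_Icc _ _) isCompact_Icc
  refine ⟨K, fun a ha => ?_⟩
  have hla := hK.dist_le_mul a (abs_le.1 ha.le) 0 ⟨neg_nonpos.2 ha₀, ha₀⟩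
  rw [Real.dist_eq, Real.dist_eq, sub_zero] at hla
  calc |a ^ 2 * (l a - l 0)| = |a| ^ 2 * |l a - l 0| := by rw [abs_mul, abs_pow]
    _ ≤ |a| ^ 2 * (K * |a|) := by gcongr
    _ = K * |a| ^ 3 := by ring

end Remainders

end

theorem mainTheorem2 (T κ : ℝ) (hT : 0 ≤ T) (hκ : 0 < κ)
    (hres : ∀ n : ℕ, 2 ≤ n → cww T κ ≠ cww T (n * κ))
    (hone : cww T κ ≠ 1) :
    ∃ (a₀ : ℝ) (η u : ℝ → ℝ → ℝ) (c : ℝ → ℝ), 0 < a₀ ∧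
      -- for every small amplitude `a`, a smooth, even, periodic traveling wave
      (∀ a : ℝ, |a| < a₀ → IsEvenPeriodicTravelingWave T κ (c a) (η a) (u a)) ∧
      -- smooth dependence on the parameter
      ContDiffOn ℝ ∞ (fun p : ℝ × ℝ => η p.1 p.2) (Set.Ioo (-a₀) a₀ ×ˢ Set.univ) ∧
      ContDiffOn ℝ ∞ (fun p : ℝ × ℝ => u p.1 p.2) (Set.Ioo (-a₀) a₀ ×ˢ Set.univ) ∧
      ContDiffOn ℝ ∞ c (Set.Ioo (-a₀) a₀) ∧
      -- expansions, with remainders `O(a³)` uniformly in `z` together with all `z`-derivatives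
      (∀ k : ℕ, ∃ C : ℝ, ∀ a : ℝ, |a| < a₀ → ∀ z : ℝ,
        |iteratedDeriv k (fun x : ℝ => η a x -
          (a * cww T κ * Real.cos x +
            a ^ 2 * (cww T κ * hZero T κ - 1 / 4 +
              (cww T κ * hTwo T κ - 1 / 4) * Real.cos (2 * x)))) z| ≤ C * |a| ^ 3) ∧
      (∀ k : ℕ, ∃ C : ℝ, ∀ a : ℝ, |a| < a₀ → ∀ z : ℝ,
        |iteratedDeriv k (fun x : ℝ => u a x -
          (a * Real.cos x +
            a ^ 2 * (hZero T κ + hTwo T κ * Real.cos (2 * x)))) z| ≤ C * |a| ^ 3) ∧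
      (∃ C : ℝ, ∀ a : ℝ, |a| < a₀ →
        |c a - (cww T κ +
          3 / 2 * a ^ 2 * (hZero T κ + 1 / 2 * hTwo T κ - 1 / (8 * cww T κ)))|
          ≤ C * |a| ^ 3) := by
  obtain ⟨a₀, l, r, ha₀, hl, hr, hl0, hwave⟩ :=
    exists_wave_family hT hκ fun _ => sub_cww_sq_ne_zero hres hone
  have hu := contDiffOn_smul_waveProfile (CosineSeries.cosine 1) (secondProfile T κ) hr
  have hc : ContDiffOn ℝ ∞ (fun a => cww T κ + a ^ 2 * l a) (Set.Icc (-a₀) a₀) := by fun_prop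
  have hsub : Set.Ioo (-a₀) a₀ ⊆ Set.Icc (-a₀) a₀ := Set.Ioo_subset_Icc_self
  refine ⟨a₀, _, _, _, ha₀, fun a ha => hwave a (abs_le.1 ha.le),
    CosineSeries.contDiffOn_eval_prod ((contDiffOn_elevation hc hu).mono hsub),
    CosineSeries.contDiffOn_eval_prod (hu.mono hsub), hc.mono hsub,
    fun k => ?_, fun k => ?_, ?_⟩
  · simp only [eval_elevation_smul_waveProfile_sub]
    exact exists_abs_iteratedDeriv_eval_cube_smul_le
      (continuousOn_elevationRemainder _ _ _ hl.continuousOn hr.continuousOn) k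
  · simp only [eval_smul_waveProfile_sub]
    exact exists_abs_iteratedDeriv_eval_cube_smul_le hr.continuousOn k
  · convert exists_abs_sq_mul_sub_le ha₀.le hl using 6
    rw [hl0]
    ring
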